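/- Let $\mathcal C$ be a closed, non-self-intersecting planar curve of length $L>0$, given by an $L$-periodic $C^4$ arc-length parametrization $\mathbf v:\mathbb R\to\mathbb R^2$ that is injective on $[0,L)$, and let $\mathcal C$ be strictly convex in the sense that its signed curvature $k=\det(\mathbf v',\mathbf v'')$ satisfies $k(s)>0$ for all $s\in[0,L]$. Write $\mathbf w^\perp=(w_2,-w_1)$ for $\mathbf w=(w_1,w_2)$, let $\mathbf n(s)=\mathbf v'(s)^\perp$ be the (outward) unit normal, and let $(\Delta x)_i=x_{i+1}-x_i$ for a sequence $x$ indexed by $\mathbb Z$. The subdivision operators $S_p$ are defined by $(S_0x)_{2i}=(S_0x)_{2i+1}=x_i$ and $(S_px)_i=\tfrac12\big((S_{p-1}x)_i+(S_{p-1}x)_{i+1}\big)$ for $i\in\mathbb Z$. Let $p\ge 3$ and $I_i=\{i,i+1,\dots,i+p+1\}$. For a real sequence $x$ put $\|x\|=\sup_{k\in\mathbb Z}|x_k|$ and $\|x\|_{I_i}=\max_{k\in I_i}|x_k|$. Initial data: let $N\ge\lceil p/2\rceil+1$ and let $s^0=(s^0_i)_{i\in\mathbb Z}$ be strictly increasing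 with $s^0_{i+N}=s^0_i+L$ for all $i$ (thus $\mathbf v(s^0_0),\dots,\mathbf v(s^0_{N-1})$ are $N$ distinct points of $\mathcal C$). The $(S_p,S_{p-2})$ normal multi-scale transform: let the sequences $s^j$ ($j\ge0$) and $d^j$ ($j\ge1$) satisfy, with $\mathbf v^j_K=\mathbf v(s^j_K)$, for all $j\ge1$ and $K\in\mathbb Z$, $$\mathbf v^j_K=(S_p\mathbf v^{j-1})_K+d^j_K\,\hat{\mathbf n}^j_K,\qquad \hat{\mathbf n}^j_K=\frac{(S_{p-2}\Delta\mathbf v^{j-1})_K^{\perp}}{|(S_{p-2}\Delta\mathbf v^{j-1})_K|},\qquad d^j_K>0,$$ and $s^j_K\in[s^{j-1}_i,s^{j-1}_{i+p+1}]$ for every $i$ with $K\in I_{2i}\cup I_{2i+1}$. Let $\xi^j_K$ ($j\ge1$, $K\in\mathbb Z$) be parameters of the approximate normals: $\hat{\mathbf n}^j_K=\mathbf n(\xi^j_K)$ and, for some constant $C_1$ independent of $i,j,k,K$, $|\xi^j_K-s^{j-1}_k|\le C_1\|\Delta s^{j-1}\|_{I_i}$ whenever $k\in I_i$ and $K\in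 I_{2i}\cup I_{2i+1}$. Suppose that the transform converges, i.e. that the piecewise linear functions $s^j(t)$ with $s^j(2^{-j}i)=s^j_i$ for all $i\in\mathbb Z$ converge pointwise, as $j\to\infty$, to a continuous function $s(t)$ on $\mathbb R$. Then there is a constant $C>0$ such that $$|\xi^j_K-s^j_K|\le C\,\|\Delta s^{j-1}\|^2\qquad\text{for all } j\ge1,\ K\in\mathbb Z.$$ -/

import Mathlib

noncomputable section

namespace NormalMT

/-- The Euclidean plane. -/
abbrev Plane := EuclideanSpace ℝ (Fin 2)

/-- `v` is an arc-length parametrization (period `L`) of a closed, non-self-intersecting,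
regular `C^1` planar curve of length `L`. -/
structure IsClosedCurve (v : ℝ → Plane) (L : ℝ) : Prop where
  length_pos : 0 < L
  periodic : Function.Periodic v L
  injOn : Set.InjOn v (Set.Ico 0 L)
  contDiff : ContDiff ℝ 1 v
  unit_speed : ∀ s, ‖deriv v s‖ = 1

/-- Signed curvature `det (v', v'')` of an arc-length parametrized planar curve; it is positive
where the curve turns to the left. -/
def curvature (v : ℝ → Plane) (s : ℝ) : ℝ :=
  deriv v s 0 * deriv (deriv v) s 1 - deriv v s 1 * deriv (deriv v) s 0

/-- The perpendicular `w^⊥`: rotation by a right angle, clockwise, so that for a curve that turns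
to the left the rotated tangent is the outward normal. -/
def perp (w : Plane) : Plane := !₂[w 1, -(w 0)]

/-- The unit normal `n(s)` of an arc-length parametrized curve. -/
def unitNormal (v : ℝ → Plane) (s : ℝ) : Plane := perp (deriv v s)

section Sequences

variable {E : Type*} [AddCommGroup E] [Module ℝ E]

/-- The subdivision operator `S_p` (Lane-Riesenfeld algorithm, non-centered form):
`(S_0 x)_{2i} = (S_0 x)_{2i+1} = x_i` and `(S_{p+1} x)_i = ((S_p x)_i + (S_p x)_{i+1}) / 2`.
Integer division rounds down here. -/
def subdiv : ℕ → (ℤ → E) → ℤ → E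
  | 0, x => fun i => x (i / 2)
  | p + 1, x => fun i => (1 / 2 : ℝ) • (subdiv p x i + subdiv p x (i + 1))

end Sequences

/-- The forward difference `(Δ x)_i = x_{i+1} - x_i`. -/
def fdiff {E : Type*} [AddCommGroup E] (x : ℤ → E) : ℤ → E := fun i => x (i + 1) - x i

/-- The `ℓ_∞`-norm of a real sequence. -/
def supNorm (x : ℤ → ℝ) : ℝ := ⨆ k : ℤ, |x k|

/-- The `ℓ_∞`-norm of the subsequence with indices in `I`. -/
def supNormOn (I : Set ℤ) (x : ℤ → ℝ) : ℝ := ⨆ k : I, |x k|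

/-- The invariant neighbourhood `I_i = i + [0, p+1]` of the index `i` for `S_p`. -/
def nbhd (p : ℕ) (i : ℤ) : Set ℤ := Set.Icc i (i + p + 1)

/-- The approximate normal `(S_q Δx)_K^⊥ / |(S_q Δx)_K|` generated by the operator `S_q` from the
coarse data `x`. -/
def approxNormal (q : ℕ) (x : ℤ → Plane) (K : ℤ) : Plane :=
  ‖subdiv q (fdiff x) K‖⁻¹ • perp (subdiv q (fdiff x) K)

/-- `s⁰` lists, in increasing order, the arc-length parameters of `N` distinct points on a closed
curve of length `L`, extended by `s⁰_{i+N} = s⁰_i + L`. -/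
structure IsInitialData (L : ℝ) (N : ℕ) (s₀ : ℤ → ℝ) : Prop where
  strictMono : StrictMono s₀
  add_period : ∀ i, s₀ (i + N) = s₀ i + L

/-- `s j` (`j = 0, 1, 2, …`) are the arc-length sequences and `d j` (`j ≥ 1`) the detail sequences
of the `(S_p, S_{p-2})` normal multi-scale transform of the curve `v` with initial data `v ∘ s₀`:
with `vʲ = v ∘ sʲ`, the predicted point `(S_p vʲ)_K` is moved along the ray in the direction of the
(outward) approximate normal until the curve is hit, and the parameter of the new point is taken
on the interval spanned by `sʲ` on the invariant neighbourhood.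
Nothing is required of `d 0`. -/
structure IsNormalMT (v : ℝ → Plane) (p : ℕ) (s₀ : ℤ → ℝ) (s d : ℕ → ℤ → ℝ) : Prop where
  init : s 0 = s₀
  refine_eq : ∀ j K, v (s (j + 1) K) =
    subdiv p (v ∘ s j) K + d (j + 1) K • approxNormal (p - 2) (v ∘ s j) K
  detail_pos : ∀ j K, 0 < d (j + 1) K
  mem_interval : ∀ j i, ∀ K ∈ nbhd p (2 * i) ∪ nbhd p (2 * i + 1),
    s (j + 1) K ∈ Set.Icc (s j i) (s j (i + p + 1))

/-- `ξ j` (`j ≥ 1`) are arc-length parameters of the approximate normals of the `(S_p, S_{p-2})`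
transform: the `K`-th approximate normal is `n(ξ_K)`, and
`|ξ_K - s_k| ≤ C₁ ‖Δs‖_{I_i}` for `k ∈ I_i`, `K ∈ I_{2i} ∪ I_{2i+1}`, with `s` of level `j - 1`.
Nothing is required of `ξ 0`. -/
structure AreNormalParams (v : ℝ → Plane) (p : ℕ) (s : ℕ → ℤ → ℝ) (C₁ : ℝ)
    (ξ : ℕ → ℤ → ℝ) : Prop where
  normal_eq : ∀ j K, approxNormal (p - 2) (v ∘ s j) K = unitNormal v (ξ (j + 1) K)
  near : ∀ j i, ∀ K ∈ nbhd p (2 * i) ∪ nbhd p (2 * i + 1), ∀ k ∈ nbhd p i,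
    |ξ (j + 1) K - s j k| ≤ C₁ * supNormOn (nbhd p i) (fdiff (s j))

/-- The piecewise linear function with values `x i` at the grid points `2^{-j} i`, `i ∈ ℤ`. -/
def interpolant (j : ℕ) (x : ℤ → ℝ) (t : ℝ) : ℝ :=
  x ⌊2 ^ j * t⌋ + Int.fract (2 ^ j * t) * fdiff x ⌊2 ^ j * t⌋

/-- The transform converges: the arc-length interpolants `sʲ(t)` have a continuous limit `s(t)`
as `j → ∞`. Only pointwise convergence is asked for. -/
def Converges (s : ℕ → ℤ → ℝ) : Prop :=
  ∃ σ : ℝ → ℝ, Continuous σ ∧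
    ∀ t, Filter.Tendsto (fun j => interpolant j (s j) t) Filter.atTop (nhds (σ t))

end NormalMT

end

/-! Fix a level with coarse parameters s. Write a = ξ_K, u_k = s_k − a, h = ‖Δs‖, D = ‖Δ²s‖, and
expand v about a to third order. The predicted point is displaced orthogonally to v'(a), so the
tangential component gives the new parameter as (S_p s)_K + O(h³) (`abs_next_sub_subdiv_le`). The
normal component of (S_{p-2} Δv)_K vanishes; as the curvature is bounded below, (S_{p-2} Δ(u²))_K =
O(h³) (`abs_subdiv_fdiff_sq_le`).

If u is affine with slope δ, then S_{p-2} Δ(u²) = 2δ S_p u exactly: the half step by which Δ(u²) is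
off centre is the shift produced by two further averagings. For nearly affine u, division by δ
yields (S_p u)_K = O(h² + D) (`abs_subdiv_le_of_subdiv_fdiff_sq`). Since (S_p u)_K = (S_p s)_K −
ξ_K, only D = O(h²) remains.

By the tangential estimate, refinement halves the bound for h and quarters that for D, up to O(h³),
while h ≥ c 2^{-j} because O(2^j) steps cover the length L. Once h is small, D is O(4^{-j}), hence
O(h²); while h is bounded below, D ≤ 2h suffices (`exists_le_mul_sq`). -/

namespace NormalMT

/-! ### Subdivision operators: differences, locality, affine sequences -/

section Subdivision

variable {E F : Type*} [AddCommGroup E] [Module ℝ E] [AddCommGroup F] [Module ℝ F]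

theorem map_subdiv (φ : E →ₗ[ℝ] F) (p : ℕ) (x : ℤ → E) (i : ℤ) :
    φ (subdiv p x i) = subdiv p (fun k => φ (x k)) i := by
  induction p generalizing i with
  | zero => rfl
  | succ p ih => simp only [subdiv, map_smul, map_add, ih]

theorem subdiv_add (p : ℕ) (x y : ℤ → E) (i : ℤ) :
    subdiv p (fun k => x k + y k) i = subdiv p x i + subdiv p y i := by
  induction p generalizing i with
  | zero => rfl
  | succ p ih => simp only [subdiv, ih]; module

theorem subdiv_sub (p : ℕ) (x y : ℤ → E) (i : ℤ) :
    subdiv p (fun k => x k - y k) i = subdiv p x i - subdiv p y i := by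
  induction p generalizing i with
  | zero => rfl
  | succ p ih => simp only [subdiv, ih]; module

theorem subdiv_const (p : ℕ) (c : E) (i : ℤ) : subdiv p (fun _ => c) i = c := by
  induction p generalizing i with
  | zero => rfl
  | succ p ih => simp only [subdiv, ih]; module

theorem subdiv_const_mul (p : ℕ) (c : ℝ) (x : ℤ → ℝ) (i : ℤ) :
    subdiv p (fun k => c * x k) i = c * subdiv p x i :=
  (map_subdiv (LinearMap.mulLeft ℝ c) p x i).symm

theorem subdiv_shift (p : ℕ) (x : ℤ → E) (i : ℤ) :
    subdiv p x (i + 2) = subdiv p (fun k => x (k + 1)) i := by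
  induction p generalizing i with
  | zero =>
    have : (i + 2) / 2 = i / 2 + 1 := by omega
    simp only [subdiv, this]
  | succ p ih =>
    simp only [subdiv, ← ih]
    rw [show i + 2 + 1 = i + 1 + 2 by ring]

/-- The difference of two neighbouring averages telescopes to a fine shift by two, which is a coarse
shift by one. Each Δ thus gains a factor 1/2 and lowers the order by one. -/
theorem fdiff_subdiv (p : ℕ) (x : ℤ → E) :
    fdiff (subdiv (p + 1) x) = fun i => (1 / 2 : ℝ) • subdiv p (fdiff x) i := by
  funext i
  have h := subdiv_sub p (fun k => x (k + 1)) x i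
  rw [← subdiv_shift] at h
  change subdiv (p + 1) x (i + 1) - subdiv (p + 1) x i =
    (1 / 2 : ℝ) • subdiv p (fun k => x (k + 1) - x k) i
  rw [h]
  simp only [subdiv]
  rw [show i + 1 + 1 = i + 2 by ring]
  module

theorem fdiff_const_smul (c : ℝ) (x : ℤ → E) :
    fdiff (fun k => c • x k) = fun k => c • fdiff x k := by
  funext k; simp only [fdiff, smul_sub]

/-- Each value of `subdiv p x` is a convex combination of the coarse values in this window, so local
bounds pass through. -/
theorem abs_subdiv_le (p : ℕ) (x : ℤ → ℝ) (K : ℤ) (B : ℝ)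
    (h : ∀ k, K / 2 ≤ k → k ≤ (K + p) / 2 → |x k| ≤ B) : |subdiv p x K| ≤ B := by
  induction p generalizing K with
  | zero => exact h _ le_rfl (by simp)
  | succ p ih =>
    have h₁ := ih K fun k hk hk' => h k hk (by push_cast; omega)
    have h₂ := ih (K + 1) fun k hk hk' => h k (by omega) (by push_cast; omega)
    simp only [subdiv, smul_eq_mul]
    rw [abs_le] at *
    constructor <;> linarith [h₁.1, h₁.2, h₂.1, h₂.2]

/-- S_0 only yields ⌊K/2⌋; the first averaging removes the parity effect, and each later one shifts
by 1/4. -/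
theorem subdiv_id (q : ℕ) (K : ℤ) :
    subdiv (q + 1) (fun k => (k : ℝ)) K = K / 2 + q / 4 := by
  induction q generalizing K with
  | zero =>
    have h : K / 2 + (K + 1) / 2 = K := by omega
    have h' : ((K / 2 : ℤ) : ℝ) + ((K + 1) / 2 : ℤ) = K := by exact_mod_cast h
    simp only [subdiv, smul_eq_mul, h']
    push_cast; ring
  | succ q ih =>
    rw [subdiv]
    simp only [ih, smul_eq_mul]
    push_cast
    ring

theorem subdiv_affine (q : ℕ) (a b : ℝ) (K : ℤ) :
    subdiv (q + 1) (fun k => a + b * (k : ℝ)) K = a + b * (K / 2 + q / 4) := by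
  rw [subdiv_add, subdiv_const, subdiv_const_mul, subdiv_id]

end Subdivision

/-! ### Local norms and nearly affine sequences -/

theorem bddAbove_nbhd (p : ℕ) (i : ℤ) (x : ℤ → ℝ) :
    BddAbove (Set.range fun k : nbhd p i => |x k|) := by
  have : Finite (nbhd p i) := (Set.finite_Icc _ _).to_subtype
  exact Set.finite_range _ |>.bddAbove

theorem abs_le_supNormOn {p : ℕ} {i k : ℤ} (hk : k ∈ nbhd p i) (x : ℤ → ℝ) :
    |x k| ≤ supNormOn (nbhd p i) x :=
  le_ciSup (bddAbove_nbhd p i x) ⟨k, hk⟩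

theorem left_mem_nbhd (p : ℕ) (i : ℤ) : i ∈ nbhd p i := ⟨le_rfl, by omega⟩

theorem supNormOn_le {p : ℕ} {i : ℤ} {x : ℤ → ℝ} {B : ℝ} (h : ∀ k ∈ nbhd p i, |x k| ≤ B) :
    supNormOn (nbhd p i) x ≤ B := by
  have : Nonempty (nbhd p i) := ⟨⟨i, left_mem_nbhd p i⟩⟩
  exact ciSup_le fun k => h k k.2

theorem supNormOn_nonneg (p : ℕ) (i : ℤ) (x : ℤ → ℝ) : 0 ≤ supNormOn (nbhd p i) x :=
  (abs_nonneg _).trans (abs_le_supNormOn (left_mem_nbhd p i) x)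

theorem abs_fdiff_sub_le {u : ℤ → ℝ} {D : ℝ} (hD : ∀ k, |fdiff (fdiff u) k| ≤ D) (i : ℤ) (n : ℕ) :
    |fdiff u (i + n) - fdiff u i| ≤ n * D := by
  induction n with
  | zero => simp
  | succ n ih =>
    have h := hD (i + n)
    rw [fdiff] at h
    rw [abs_le] at *
    push_cast
    rw [← add_assoc]
    constructor <;> linarith [h.1, h.2, ih.1, ih.2]

theorem abs_sub_affine_le {u : ℤ → ℝ} {D : ℝ} (hD : ∀ k, |fdiff (fdiff u) k| ≤ D) (i : ℤ) (n : ℕ) :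
    |u (i + n) - (u i + n * fdiff u i)| ≤ n ^ 2 * D := by
  have hD0 : 0 ≤ D := (abs_nonneg _).trans (hD 0)
  induction n with
  | zero => simp
  | succ n ih =>
    have h := abs_fdiff_sub_le hD i n
    have h₁ : u (i + (n + 1 : ℕ)) = u (i + n) + fdiff u (i + n) := by
      simp only [fdiff]; push_cast; rw [← add_assoc]; ring
    rw [h₁]
    have h₂ : (0 : ℝ) ≤ n * D := by positivity
    rw [abs_le] at *
    push_cast
    constructor <;> nlinarith [h.1, h.2, ih.1, ih.2]

/-- If `S_{p-2} Δ(u²)` is of third order at `K` and `u` is locally close to an affine sequence,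
then `S_p u` is of second order at `K`. -/
theorem abs_subdiv_le_of_subdiv_fdiff_sq (q : ℕ) (u : ℤ → ℝ) (K : ℤ) (h D A E : ℝ)
    (hh : h = supNormOn (nbhd (q + 3) (K / 2)) (fdiff u))
    (hD : ∀ k, |fdiff (fdiff u) k| ≤ D) (hA0 : 0 ≤ A)
    (hA : ∀ k ∈ nbhd (q + 3) (K / 2), |u k| ≤ A * h)
    (hE0 : 0 ≤ E)
    (hE : |subdiv (q + 1) (fdiff fun k => u k ^ 2) K| ≤ E * h ^ 3) :
    |subdiv (q + 3) u K| ≤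
      (E + 2 * (q + 4) ^ 2 * (2 * A + (q + 4)) + (q + 4) ^ 2 + 2 * A * (q + 4)) * (h ^ 2 + D) := by
  set i := K / 2 with hi
  have hh0 : 0 ≤ h := hh ▸ supNormOn_nonneg _ _ _
  have hD0 : 0 ≤ D := (abs_nonneg _).trans (hD 0)
  set P : ℝ := q + 4 with hP
  have hP0 : 0 ≤ P := by positivity
  set δ := fdiff u i with hδ
  have hδh : |δ| ≤ h := by
    rw [hh, hδ]; exact abs_le_supNormOn (left_mem_nbhd _ _) (fdiff u)
  have hnat : ∀ k ∈ nbhd (q + 3) i, ∃ n : ℕ, k = i + n ∧ (n : ℝ) ≤ P := by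
    intro k hk
    obtain ⟨n, hn⟩ := Int.eq_ofNat_of_zero_le (sub_nonneg.2 hk.1)
    have h' := hk.2
    refine ⟨n, by omega, ?_⟩
    have : n ≤ q + 4 := by push_cast at h'; omega
    rw [hP]; exact_mod_cast this
  -- Across the window the slopes vary by at most P D, so δ is comparable to h unless D dominates.
  have hle : h ≤ |δ| + P * D := by
    rw [hh]
    refine supNormOn_le fun k hk => ?_
    obtain ⟨n, rfl, hn⟩ := hnat k hk
    have h₁ := abs_fdiff_sub_le hD i n
    have h₂ : (n : ℝ) * D ≤ P * D := by gcongr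
    have h₃ := abs_add_le (fdiff u (i + n) - fdiff u i) (fdiff u i)
    rw [sub_add_cancel] at h₃
    linarith
  set y : ℤ → ℝ := fun k => (u i - δ * i) + δ * k with hy
  have hyk : ∀ n : ℕ, y (i + n) = u i + n * δ := by
    intro n; simp only [hy]; push_cast; ring
  have he : ∀ k ∈ nbhd (q + 3) i, |u k - y k| ≤ P ^ 2 * D := by
    intro k hk
    obtain ⟨n, rfl, hn⟩ := hnat k hk
    rw [hyk]
    refine (abs_sub_affine_le hD i n).trans ?_
    gcongr
  have hyb : ∀ k ∈ nbhd (q + 3) i, |y k| ≤ (A + P) * h := by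
    intro k hk
    obtain ⟨n, rfl, hn⟩ := hnat k hk
    rw [hyk]
    have h₁ := hA i (left_mem_nbhd _ _)
    have h₂ : |(n : ℝ) * δ| ≤ P * h := by
      rw [abs_mul, Nat.abs_cast]; gcongr
    linarith [abs_add_le (u i) (n * δ)]
  have hsq : ∀ k ∈ nbhd (q + 3) i, |u k ^ 2 - y k ^ 2| ≤ P ^ 2 * D * ((2 * A + P) * h) := by
    intro k hk
    rw [show u k ^ 2 - y k ^ 2 = (u k - y k) * (u k + y k) by ring, abs_mul]
    have h₁ := abs_add_le (u k) (y k)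
    have h₂ := hA k hk
    have h₃ := hyb k hk
    have := he k hk
    gcongr
    linarith
  have hSu : |subdiv (q + 3) u K| ≤ A * h := by
    refine abs_subdiv_le _ _ _ _ fun k hk hk' => hA k ⟨hk, ?_⟩
    push_cast at hk' ⊢; omega
  have hSe : |subdiv (q + 3) u K - subdiv (q + 3) y K| ≤ P ^ 2 * D := by
    rw [← subdiv_sub]
    refine abs_subdiv_le _ _ _ _ fun k hk hk' => he k ⟨hk, ?_⟩
    push_cast at hk' ⊢; omega
  have hSsq : |subdiv (q + 1) (fdiff fun k => u k ^ 2) K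
      - subdiv (q + 1) (fdiff fun k => y k ^ 2) K| ≤ 2 * (P ^ 2 * D * ((2 * A + P) * h)) := by
    rw [← subdiv_sub]
    refine abs_subdiv_le _ _ _ _ fun k hk hk' => ?_
    have h₁ := hsq k ⟨hk, by push_cast at hk' ⊢; omega⟩
    have h₂ := hsq (k + 1) ⟨by omega, by push_cast at hk' ⊢; omega⟩
    simp only [fdiff]
    rw [abs_le] at *
    constructor <;> linarith [h₁.1, h₁.2, h₂.1, h₂.2]
  -- The increment is Δ(y²)_k = 2δ(y_k + δ/2), and the offsets q/4 and (q+2)/4 differ by exactly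
  -- this half step.
  have hSy : subdiv (q + 1) (fdiff fun k => y k ^ 2) K = 2 * δ * subdiv (q + 3) y K := by
    have h₁ : (fdiff fun k => y k ^ 2) =
        fun k : ℤ => δ * (2 * (u i - δ * i) + δ) + 2 * δ ^ 2 * (k : ℝ) := by
      funext k; simp only [fdiff, hy]; push_cast; ring
    rw [h₁, subdiv_affine, hy, show q + 3 = (q + 2) + 1 by ring, subdiv_affine]
    push_cast; ring
  -- If h ≲ D, the trivial bound A h is already O(D). Otherwise |δ| ≥ h/2 and division by δ is safe.
  rcases le_or_gt h (2 * P * D) with hc | hc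
  · refine hSu.trans ?_
    have h₁ : A * h ≤ A * (2 * P * D) := by gcongr
    refine h₁.trans ?_
    have h₂ : 0 ≤ (E + 2 * P ^ 2 * (2 * A + P) + P ^ 2) * (h ^ 2 + D) := by positivity
    have h₃ : 0 ≤ 2 * A * P * h ^ 2 := by positivity
    linarith
  · have hhpos : 0 < h := lt_of_le_of_lt (by positivity) hc
    have hδ2 : h / 2 ≤ |δ| := by linarith
    rw [hSy] at hSsq
    have h₁ : |2 * δ * subdiv (q + 3) y K| ≤
        E * h ^ 3 + 2 * (P ^ 2 * D * ((2 * A + P) * h)) := by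
      rw [abs_le] at *
      constructor <;> linarith [hE.1, hE.2, hSsq.1, hSsq.2]
    rw [abs_mul, abs_mul, abs_two] at h₁
    have h₂ : h * |subdiv (q + 3) y K| ≤ h * (E * h ^ 2 + 2 * P ^ 2 * (2 * A + P) * D) := by
      have : h * |subdiv (q + 3) y K| ≤ 2 * |δ| * |subdiv (q + 3) y K| := by
        gcongr; linarith
      linarith
    have h₃ := le_of_mul_le_mul_left h₂ hhpos
    have h₄ : |subdiv (q + 3) u K| ≤ E * h ^ 2 + 2 * P ^ 2 * (2 * A + P) * D + P ^ 2 * D := by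
      have := abs_add_le (subdiv (q + 3) u K - subdiv (q + 3) y K) (subdiv (q + 3) y K)
      rw [sub_add_cancel] at this
      linarith
    have h₅ : 0 ≤ (2 * P ^ 2 * (2 * A + P) + P ^ 2) * h ^ 2 + E * D + 2 * A * P * (h ^ 2 + D) := by
      positivity
    linarith

/-! ### Taylor expansion of the curve along tangent and normal -/

theorem norm_le_mul_pow_succ_of_hasDerivAt {E : Type*} [NormedAddCommGroup E] [NormedSpace ℝ E]
    {G G' : ℝ → E} {a M : ℝ} {n : ℕ} (hG : ∀ t, HasDerivAt G (G' t) t) (ha : G a = 0)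
    (hM : 0 ≤ M) (hG' : ∀ t, ‖G' t‖ ≤ M * |t - a| ^ n) (t : ℝ) :
    ‖G t‖ ≤ M * |t - a| ^ (n + 1) := by
  have h := (convex_uIcc a t).norm_image_sub_le_of_norm_hasDerivWithin_le
    (f := G) (f' := G') (C := M * |t - a| ^ n) (fun x _ => (hG x).hasDerivWithinAt)
    (fun x hx => (hG' x).trans (by
      gcongr ?_ * ?_ ^ n
      exact Set.abs_sub_left_of_mem_uIcc hx))
    Set.left_mem_uIcc Set.right_mem_uIcc
  rw [ha, sub_zero, Real.norm_eq_abs] at h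
  calc _ ≤ _ := h
    _ = _ := by ring

/-- Third order Taylor estimate. -/
theorem norm_sub_taylor_le {E : Type*} [NormedAddCommGroup E] [NormedSpace ℝ E] {v : ℝ → E}
    (hv : ContDiff ℝ 3 v) {M : ℝ} (hM : ∀ t, ‖deriv (deriv (deriv v)) t‖ ≤ M) (a t : ℝ) :
    ‖v t - v a - (t - a) • deriv v a - ((t - a) ^ 2 / 2) • deriv (deriv v) a‖ ≤
      M * |t - a| ^ 3 := by
  have hM0 : 0 ≤ M := (norm_nonneg _).trans (hM 0)
  have hv1 : ContDiff ℝ 2 (deriv v) := (contDiff_succ_iff_deriv (n := 2)).1 hv |>.2.2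
  have hv2 : ContDiff ℝ 1 (deriv (deriv v)) := (contDiff_succ_iff_deriv (n := 1)).1 hv1 |>.2.2
  have d0 : ∀ t, HasDerivAt v (deriv v t) t :=
    fun t => (hv.differentiable (by norm_num) t).hasDerivAt
  have d1 : ∀ t, HasDerivAt (deriv v) (deriv (deriv v) t) t :=
    fun t => (hv1.differentiable (by norm_num) t).hasDerivAt
  have d2 : ∀ t, HasDerivAt (deriv (deriv v)) (deriv (deriv (deriv v)) t) t :=
    fun t => (hv2.differentiable (by norm_num) t).hasDerivAt
  have e2 : ∀ t, ‖deriv (deriv v) t - deriv (deriv v) a‖ ≤ M * |t - a| ^ 1 :=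
    norm_le_mul_pow_succ_of_hasDerivAt (n := 0) (fun t => (d2 t).sub_const _) (sub_self _) hM0
      (fun t => by simpa using hM t)
  have e1 : ∀ t, ‖deriv v t - deriv v a - (t - a) • deriv (deriv v) a‖ ≤ M * |t - a| ^ 2 :=
    norm_le_mul_pow_succ_of_hasDerivAt (fun t => by
      have := ((d1 t).sub_const (deriv v a)).sub
        (((hasDerivAt_id t).sub_const a).smul_const (deriv (deriv v) a))
      exact this.congr_deriv (by simp)) (by simp) hM0 e2
  refine norm_le_mul_pow_succ_of_hasDerivAt
    (G := fun t => v t - v a - (t - a) • deriv v a - ((t - a) ^ 2 / 2) • deriv (deriv v) a)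
    (fun t => ?_) (by simp) hM0 e1 t
  have h1 := ((d0 t).sub_const (v a)).sub (((hasDerivAt_id t).sub_const a).smul_const (deriv v a))
  have h2 : HasDerivAt (fun t : ℝ => (t - a) ^ 2 / 2) (t - a) t := by
    have := (((hasDerivAt_id t).sub_const a).pow 2).div_const 2
    refine this.congr_deriv ?_
    simp
  have h3 := h1.sub (h2.smul_const (deriv (deriv v) a))
  exact h3.congr_deriv (by simp)

theorem periodic_deriv {E : Type*} [NormedAddCommGroup E] [NormedSpace ℝ E] {v : ℝ → E} {L : ℝ}
    (hv : Function.Periodic v L) : Function.Periodic (deriv v) L := by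
  intro t
  rw [← deriv_comp_add_const]
  congr 1
  funext x
  exact hv x

theorem exists_norm_le_of_periodic {E : Type*} [NormedAddCommGroup E] {f : ℝ → E} {L : ℝ}
    (hL : 0 < L) (hf : Function.Periodic f L) (hc : Continuous f) : ∃ M, ∀ t, ‖f t‖ ≤ M := by
  obtain ⟨M, hM⟩ := (hf.isBounded_of_continuous hL.ne' hc).exists_norm_le
  exact ⟨M, fun t => hM _ ⟨t, rfl⟩⟩

theorem exists_pos_le_of_periodic {f : ℝ → ℝ} {L : ℝ} (hL : 0 < L) (hf : Function.Periodic f L)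
    (hc : Continuous f) (hpos : ∀ t ∈ Set.Icc 0 L, 0 < f t) : ∃ κ, 0 < κ ∧ ∀ t, κ ≤ f t := by
  obtain ⟨a, ha, hmin⟩ := isCompact_Icc.exists_isMinOn (Set.nonempty_Icc.2 hL.le) hc.continuousOn
  refine ⟨f a, hpos a ha, fun t => ?_⟩
  obtain ⟨y, hy, hty⟩ := hf.exists_mem_Ico₀ hL t
  rw [hty]
  exact hmin (Set.Ico_subset_Icc_self hy)

/-- The coordinate of `w` along `T`. -/
def dotL (T : Plane) : Plane →ₗ[ℝ] ℝ where
  toFun w := T 0 * w 0 + T 1 * w 1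
  map_add' x y := by simp; ring
  map_smul' c x := by simp; ring

/-- The determinant `det (T, w)`. -/
def detL (T : Plane) : Plane →ₗ[ℝ] ℝ where
  toFun w := T 0 * w 1 - T 1 * w 0
  map_add' x y := by simp; ring
  map_smul' c x := by simp; ring

theorem plane_norm_sq (w : Plane) : ‖w‖ ^ 2 = w 0 ^ 2 + w 1 ^ 2 := by
  rw [EuclideanSpace.real_norm_sq_eq, Fin.sum_univ_two]

theorem abs_dotL_le {T : Plane} (hT : ‖T‖ = 1) (w : Plane) : |dotL T w| ≤ ‖w‖ := by
  have h := plane_norm_sq T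
  rw [hT] at h
  refine abs_le_of_sq_le_sq ?_ (norm_nonneg _)
  rw [plane_norm_sq]
  change (T 0 * w 0 + T 1 * w 1) ^ 2 ≤ _
  have : (w 0 ^ 2 + w 1 ^ 2) = (w 0 ^ 2 + w 1 ^ 2) * (T 0 ^ 2 + T 1 ^ 2) := by rw [← h]; ring
  rw [this]
  nlinarith [sq_nonneg (T 0 * w 1 - T 1 * w 0)]

theorem abs_detL_le {T : Plane} (hT : ‖T‖ = 1) (w : Plane) : |detL T w| ≤ ‖w‖ := by
  have h := plane_norm_sq T
  rw [hT] at h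
  refine abs_le_of_sq_le_sq ?_ (norm_nonneg _)
  rw [plane_norm_sq]
  change (T 0 * w 1 - T 1 * w 0) ^ 2 ≤ _
  have : (w 0 ^ 2 + w 1 ^ 2) = (w 0 ^ 2 + w 1 ^ 2) * (T 0 ^ 2 + T 1 ^ 2) := by rw [← h]; ring
  rw [this]
  nlinarith [sq_nonneg (T 0 * w 0 + T 1 * w 1)]

theorem dotL_self {T : Plane} (hT : ‖T‖ = 1) : dotL T T = 1 := by
  have h := plane_norm_sq T
  rw [hT] at h
  change T 0 * T 0 + T 1 * T 1 = 1
  linarith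

theorem detL_self (T : Plane) : detL T T = 0 := by
  change T 0 * T 1 - T 1 * T 0 = 0; ring

theorem dotL_perp (T : Plane) : dotL T (perp T) = 0 := by
  change T 0 * T 1 + T 1 * -(T 0) = 0; ring

theorem detL_eq_zero_of_smul_perp {T w : Plane} {c : ℝ}
    (h : c • perp w = perp T) : detL T w = 0 := by
  have h0 : c * w 1 = T 1 := by simpa [perp] using congrArg (fun z : Plane => z 0) h
  have h1 : c * w 0 = T 0 := by simpa [perp] using congrArg (fun z : Plane => z 1) h
  change T 0 * w 1 - T 1 * w 0 = 0
  rw [← h0, ← h1]; ring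

theorem dotL_deriv_deriv {v : ℝ → Plane} (hv : ContDiff ℝ 2 v) (hu : ∀ s, ‖deriv v s‖ = 1)
    (t : ℝ) : dotL (deriv v t) (deriv (deriv v) t) = 0 := by
  have hv1 : ContDiff ℝ 1 (deriv v) := (contDiff_succ_iff_deriv (n := 1)).1 hv |>.2.2
  have d1 : HasDerivAt (deriv v) (deriv (deriv v) t) t :=
    (hv1.differentiable (by norm_num) t).hasDerivAt
  have hc := d1.norm_sq
  have h1 : (fun x => ‖deriv v x‖ ^ 2) = fun _ => (1 : ℝ) := by funext x; rw [hu]; norm_num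
  rw [h1] at hc
  have h2 := hc.unique (hasDerivAt_const t (1 : ℝ))
  have h3 : inner ℝ (deriv v t) (deriv (deriv v) t) = 0 := by linarith
  rw [PiLp.inner_apply, Fin.sum_univ_two] at h3
  simp only [RCLike.inner_apply, conj_trivial] at h3
  change deriv v t 0 * deriv (deriv v) t 0 + deriv v t 1 * deriv (deriv v) t 1 = 0
  linarith

/-- Tangential part of the Taylor expansion of an arc-length parametrization. -/
theorem abs_dotL_sub_le {v : ℝ → Plane} (hv : ContDiff ℝ 3 v) (hu : ∀ s, ‖deriv v s‖ = 1) {M : ℝ}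
    (hM : ∀ t, ‖deriv (deriv (deriv v)) t‖ ≤ M) (a t : ℝ) :
    |dotL (deriv v a) (v t) - dotL (deriv v a) (v a) - (t - a)| ≤ M * |t - a| ^ 3 := by
  have h := (abs_dotL_le (hu a) _).trans (norm_sub_taylor_le hv hM a t)
  simp only [map_sub, map_smul, dotL_self (hu a), smul_eq_mul,
    dotL_deriv_deriv (hv.of_le (by norm_num)) hu] at h
  simpa using h

/-- Normal part of the Taylor expansion of an arc-length parametrization. -/
theorem abs_detL_sub_le {v : ℝ → Plane} (hv : ContDiff ℝ 3 v) (hu : ∀ s, ‖deriv v s‖ = 1) {M : ℝ}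
    (hM : ∀ t, ‖deriv (deriv (deriv v)) t‖ ≤ M) (a t : ℝ) :
    |detL (deriv v a) (v t) - detL (deriv v a) (v a) - curvature v a * ((t - a) ^ 2 / 2)| ≤
      M * |t - a| ^ 3 := by
  have h := (abs_detL_le (hu a) _).trans (norm_sub_taylor_le hv hM a t)
  have hk : detL (deriv v a) (deriv (deriv v) a) = curvature v a := rfl
  simp only [map_sub, map_smul, detL_self, smul_eq_mul, hk] at h
  rw [mul_comm (curvature v a)]
  simpa using h

theorem continuous_curvature {v : ℝ → Plane} (hv : ContDiff ℝ 2 v) : Continuous (curvature v) := by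
  have hv1 : ContDiff ℝ 1 (deriv v) := (contDiff_succ_iff_deriv (n := 1)).1 hv |>.2.2
  have h1 : Continuous (deriv v) := hv1.continuous
  have h2 : Continuous (deriv (deriv v)) := hv1.continuous_deriv le_rfl
  unfold curvature
  fun_prop

theorem periodic_curvature {v : ℝ → Plane} {L : ℝ} (hv : Function.Periodic v L) :
    Function.Periodic (curvature v) L := by
  intro t
  simp only [curvature, periodic_deriv hv t, periodic_deriv (periodic_deriv hv) t]

/-! ### The coupled recursion for first and second differences -/

theorem le_of_forall_succ_le_of_ge {f : ℕ → ℝ} {J : ℕ} (h : ∀ j, J ≤ j → f (j + 1) ≤ f j) :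
    ∀ j, J ≤ j → f j ≤ f J := by
  intro j hj
  induction j, hj using Nat.le_induction with
  | base => exact le_rfl
  | succ n hn ih => exact (h n hn).trans ih

/-- If `h` essentially halves and `D` is essentially divided by four in each step, up to errors of
third order in `h`, and `h` decays no faster than `2^{-j}`, then `D` is of second order in `h`. -/
theorem exists_le_mul_sq {h D : ℕ → ℝ} {c R : ℝ} (hc : 0 < c) (hR : 1 ≤ R)
    (hlow : ∀ j, c ≤ 2 ^ j * h j) (hDh : ∀ j, D j ≤ 2 * h j) (hD0 : ∀ j, 0 ≤ D j)
    (hstep : ∀ j, h (j + 1) ≤ h j / 2 + R * h j ^ 3)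
    (Dstep : ∀ j, D (j + 1) ≤ D j / 4 + R * h j ^ 3) :
    ∃ C, 0 ≤ C ∧ ∀ j, D j ≤ C * h j ^ 2 := by
  have hpos : ∀ j, 0 < h j := fun j =>
    pos_of_mul_pos_right (hc.trans_le (hlow j)) (by positivity)
  by_cases hex : ∃ J, R * h J ≤ 1 / 4
  swap
  · push Not at hex
    -- Here h > 1/(4R) at every level, so 2h ≤ 8R h².
    refine ⟨8 * R, by positivity, fun j => (hDh j).trans ?_⟩
    nlinarith [hex j, hpos j]
  obtain ⟨J, hJ⟩ := hex
  have hcontr : ∀ j, R * h j ≤ 1 / 4 → h (j + 1) ≤ 3 / 4 * h j := by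
    intro j hj
    have h1 : h j ≤ 1 := by nlinarith [hpos j]
    have h2 : R * h j ^ 3 ≤ 1 / 4 * h j := by
      have : R * h j ^ 3 = (R * h j) * (h j * h j) := by ring
      rw [this]
      have := hpos j
      gcongr
      nlinarith
    linarith [hstep j]
  have hsmall : ∀ j, J ≤ j → R * h j ≤ 1 / 4 := by
    intro j hj
    induction j, hj using Nat.le_induction with
    | base => exact hJ
    | succ n hn ih => nlinarith [hcontr n ih, hpos n]
  -- The weight exp(2h) makes 2^j h_j exp(2h_j) nonincreasing: one step costs exp(h/2), and h_{j+1}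
  -- ≤ 3h_j/4 leaves exactly exp(3h/2) to pay with.
  set M := 2 ^ J * h J * Real.exp (2 * h J) with hMdef
  have hM : ∀ j, J ≤ j → 2 ^ j * h j ≤ M := by
    intro j hj
    have hmono := le_of_forall_succ_le_of_ge (f := fun j => 2 ^ j * h j * Real.exp (2 * h j))
      (J := J) (fun j hj => ?_) j hj
    · refine le_trans ?_ hmono
      have : 1 ≤ Real.exp (2 * h j) := Real.one_le_exp (by linarith [hpos j])
      have := hpos j
      exact le_mul_of_one_le_right (by positivity) ‹_›
    · have hj0 := hpos j
      have hs := hsmall j hj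
      have h1 : 2 ^ (j + 1) * h (j + 1) ≤ 2 ^ j * h j * Real.exp (h j / 2) := by
        have h2 : 2 * h (j + 1) ≤ h j * (h j / 2 + 1) := by
          have : R * h j ^ 3 ≤ 1 / 4 * h j ^ 2 := by
            rw [show R * h j ^ 3 = R * h j * h j ^ 2 by ring]; gcongr
          linarith [hstep j]
        have h3 : h j * (h j / 2 + 1) ≤ h j * Real.exp (h j / 2) := by
          gcongr; exact Real.add_one_le_exp _
        calc (2 : ℝ) ^ (j + 1) * h (j + 1) = 2 ^ j * (2 * h (j + 1)) := by ring
          _ ≤ 2 ^ j * (h j * Real.exp (h j / 2)) := mul_le_mul_of_nonneg_left (h2.trans h3) (by positivity)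
          _ = _ := by ring
      have h4 : Real.exp (2 * h (j + 1)) ≤ Real.exp (3 / 2 * h j) := 
        Real.exp_le_exp.2 (by linarith [hcontr j hs])
      calc 2 ^ (j + 1) * h (j + 1) * Real.exp (2 * h (j + 1))
          ≤ 2 ^ j * h j * Real.exp (h j / 2) * Real.exp (3 / 2 * h j) :=
            mul_le_mul h1 h4 (Real.exp_pos _).le (by positivity)
        _ = _ := by rw [mul_assoc, ← Real.exp_add]; ring_nf
  have hM0 : 0 ≤ M := by have := hpos J; positivity
  -- The added term drops by 4RM³/2^j per step, which absorbs the error 4R·4^j h_j³.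
  set W := 4 ^ J * D J + 8 * R * M ^ 3 / 2 ^ J with hW
  have hW0 : 0 ≤ W := by have := hD0 J; positivity
  have hDW : ∀ j, J ≤ j → 4 ^ j * D j ≤ W := by
    intro j hj
    have hmono := le_of_forall_succ_le_of_ge (f := fun j => 4 ^ j * D j + 8 * R * M ^ 3 / 2 ^ j)
      (J := J) (fun j hj => ?_) j hj
    · refine le_trans ?_ hmono
      have : 0 ≤ 8 * R * M ^ 3 / 2 ^ j := by positivity
      exact le_add_of_nonneg_right this
    · have hj0 := hpos j
      have h1 : 4 ^ j * h j ^ 3 ≤ M ^ 3 / 2 ^ j := by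
        rw [le_div_iff₀ (by positivity)]
        calc (4 : ℝ) ^ j * h j ^ 3 * 2 ^ j = (2 ^ j * h j) ^ 3 := by
              rw [show (4 : ℝ) = 2 ^ 2 by norm_num, ← pow_mul]; ring
          _ ≤ M ^ 3 := by have := hM j hj; gcongr
      have h2 : 4 ^ (j + 1) * D (j + 1) ≤ 4 ^ j * D j + 4 * R * (M ^ 3 / 2 ^ j) := by
        calc (4 : ℝ) ^ (j + 1) * D (j + 1) ≤ 4 ^ (j + 1) * (D j / 4 + R * h j ^ 3) := by
              gcongr; exact Dstep j
          _ = 4 ^ j * D j + 4 * R * (4 ^ j * h j ^ 3) := by ring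
          _ ≤ _ := by gcongr
      have h3 : 8 * R * M ^ 3 / 2 ^ (j + 1) = 4 * R * (M ^ 3 / 2 ^ j) := by
        field_simp; ring
      have h4 : 8 * R * M ^ 3 / 2 ^ j = 8 * R * (M ^ 3 / 2 ^ j) := by ring
      change 4 ^ (j + 1) * D (j + 1) + 8 * R * M ^ 3 / 2 ^ (j + 1) ≤
        4 ^ j * D j + 8 * R * M ^ 3 / 2 ^ j
      rw [h3, h4]
      linarith
  refine ⟨W / c ^ 2 + 2 * 2 ^ J / c, by positivity, fun j => ?_⟩
  have hj0 := hpos j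
  rcases le_total J j with hj | hj
  · have h1 : D j ≤ W / c ^ 2 * h j ^ 2 := by
      rw [div_mul_eq_mul_div, le_div_iff₀ (by positivity)]
      calc D j * c ^ 2 ≤ D j * (2 ^ j * h j) ^ 2 := by
            have := hlow j
            have := hD0 j
            gcongr
        _ = 4 ^ j * D j * h j ^ 2 := by
            rw [show (4 : ℝ) = 2 ^ 2 by norm_num, ← pow_mul]; ring
        _ ≤ W * h j ^ 2 := by have := hDW j hj; gcongr
    have h2 : 0 ≤ 2 * 2 ^ J / c * h j ^ 2 := by positivity
    linarith
  · have h1 : 2 * h j ≤ 2 * 2 ^ J / c * h j ^ 2 := by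
      rw [div_mul_eq_mul_div, le_div_iff₀ hc]
      have h3 : (2 : ℝ) ^ j ≤ 2 ^ J := pow_le_pow_right₀ (by norm_num) hj
      have h4 : c ≤ 2 ^ J * h j := (hlow j).trans (by gcongr)
      calc 2 * h j * c ≤ 2 * h j * (2 ^ J * h j) := by gcongr
        _ = _ := by ring
    have h2 : 0 ≤ W / c ^ 2 * h j ^ 2 := by positivity
    linarith [hDh j]

/-! ### Global norms -/

theorem abs_le_supNorm {x : ℤ → ℝ} (hx : BddAbove (Set.range fun k => |x k|)) (k : ℤ) :
    |x k| ≤ supNorm x := le_ciSup hx k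

theorem supNorm_le {x : ℤ → ℝ} {B : ℝ} (h : ∀ k, |x k| ≤ B) : supNorm x ≤ B := ciSup_le h

theorem abs_fdiff_le_two_mul {x : ℤ → ℝ} {B : ℝ} (h : ∀ k, |x k| ≤ B) (k : ℤ) :
    |fdiff x k| ≤ 2 * B := by
  have h1 := h k
  have h2 := h (k + 1)
  simp only [fdiff]
  rw [abs_le] at *
  constructor <;> linarith [h1.1, h1.2, h2.1, h2.2]

theorem abs_sub_le_nat_mul {x : ℤ → ℝ} {i : ℤ} {B : ℝ} (n : ℕ)
    (h : ∀ m : ℕ, m < n → |fdiff x (i + m)| ≤ B) : |x (i + n) - x i| ≤ n * B := by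
  induction n with
  | zero => simp
  | succ n ih =>
    have h1 := ih fun m hm => h m (by omega)
    have h2 := h n (by omega)
    simp only [fdiff] at h2
    rw [abs_le] at *
    push_cast
    rw [← add_assoc]
    constructor <;> linarith [h1.1, h1.2, h2.1, h2.2]

theorem mem_nbhd_union (p : ℕ) (K : ℤ) :
    K ∈ nbhd p (2 * (K / 2)) ∪ nbhd p (2 * (K / 2) + 1) := by
  left; constructor <;> omega

/-! ### Uniform bounds on the spacing of the parameters -/

section Growth

variable {v : ℝ → Plane} {L : ℝ} {p N : ℕ} {s₀ : ℤ → ℝ} {s d : ℕ → ℤ → ℝ}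

theorem IsNormalMT.le_of_mul_le (hs : IsNormalMT v p s₀ s d) (h₀ : StrictMono s₀) (j : ℕ) :
    ∀ m K : ℤ, m * 2 ^ j ≤ K → s₀ m ≤ s j K := by
  induction j with
  | zero =>
    intro m K h
    rw [hs.init]; exact h₀.monotone (by simpa using h)
  | succ j ih =>
    intro m K h
    refine (ih m (K / 2) ?_).trans (hs.mem_interval j (K / 2) K (mem_nbhd_union p K)).1
    rw [pow_succ, ← mul_assoc] at h
    omega

/-- Right endpoints follow K ↦ ⌊K/2⌋ + p + 1. Without the floor its fixed point is 2(p+1), and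
distances to it halve. -/
theorem IsNormalMT.le_of_le_mul (hs : IsNormalMT v p s₀ s d) (h₀ : StrictMono s₀) (j : ℕ) :
    ∀ m K : ℤ, K + 2 * (p + 1) * 2 ^ j ≤ m * 2 ^ j + 2 * (p + 1) → s j K ≤ s₀ m := by
  induction j with
  | zero =>
    intro m K h
    rw [hs.init]; refine h₀.monotone ?_
    simp only [pow_zero, mul_one] at h
    omega
  | succ j ih =>
    intro m K h
    refine (hs.mem_interval j (K / 2) K (mem_nbhd_union p K)).2.trans (ih m _ ?_)
    rw [pow_succ, ← mul_assoc, ← mul_assoc] at h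
    generalize m * 2 ^ j = a at *
    generalize 2 * ((p : ℤ) + 1) * 2 ^ j = b at *
    omega

theorem IsInitialData.add_mul_period (h₀ : IsInitialData L N s₀) (i : ℤ) (n : ℕ) :
    s₀ (i + n * N) = s₀ i + n * L := by
  induction n with
  | zero => simp
  | succ n ih =>
    rw [show i + ((n + 1 : ℕ) : ℤ) * N = i + n * N + N by push_cast; ring, h₀.add_period, ih]
    push_cast; ring

/-- Both parameters lie between s₀_m and s₀_{m+2p+3} with m = ⌊K/2^j⌋. The bound is crude but makes
the suprema genuine, since an unbounded real `⨆` defaults to 0. -/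
theorem IsNormalMT.exists_abs_fdiff_le (hs : IsNormalMT v p s₀ s d) (h₀ : IsInitialData L N s₀)
    (hN : 1 ≤ N) : ∃ H, ∀ j K, |fdiff (s j) K| ≤ H := by
  refine ⟨(2 * p + 3 : ℕ) * L, fun j K => ?_⟩
  have hm1 : K / 2 ^ j * 2 ^ j ≤ K := Int.ediv_mul_le K (by positivity)
  have hm2 : K < (K / 2 ^ j + 1) * 2 ^ j := Int.lt_ediv_add_one_mul_self K (by positivity)
  set m := K / 2 ^ j
  have l1 := hs.le_of_mul_le h₀.strictMono j m K hm1
  have l2 := hs.le_of_mul_le h₀.strictMono j m (K + 1) (by omega)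
  have hu : K + 1 + 2 * (p + 1) * 2 ^ j ≤ (m + (2 * p + 3 : ℕ)) * 2 ^ j + 2 * (p + 1) := by
    push_cast; linarith
  have u1 := hs.le_of_le_mul h₀.strictMono j (m + (2 * p + 3 : ℕ)) K (by linarith)
  have u2 := hs.le_of_le_mul h₀.strictMono j (m + (2 * p + 3 : ℕ)) (K + 1) hu
  have hN' : (1 : ℤ) ≤ N := by exact_mod_cast hN
  have h3 := h₀.strictMono.monotone
    (show m + (2 * p + 3 : ℕ) ≤ m + (2 * p + 3 : ℕ) * N by nlinarith)
  rw [h₀.add_mul_period] at h3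
  simp only [fdiff]
  rw [abs_le]
  constructor <;> linarith

/-- Over (2(p+1) + N) 2^j steps the parameter advances by at least one period. -/
theorem IsNormalMT.length_le (hs : IsNormalMT v p s₀ s d) (h₀ : IsInitialData L N s₀) (j : ℕ)
    {h : ℝ} (hh : ∀ K, |fdiff (s j) K| ≤ h) :
    L ≤ 2 ^ j * h * (N + 2 * (p + 1)) := by
  have h1 := hs.le_of_mul_le h₀.strictMono j ((2 * (p + 1) : ℕ) + N)
    (0 + (((2 * (p + 1) : ℕ) + N) * 2 ^ j : ℕ)) (by push_cast; linarith)
  have h2 := hs.le_of_le_mul h₀.strictMono j (2 * (p + 1) : ℕ) 0 (by push_cast; linarith)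
  have h3 := abs_sub_le_nat_mul (x := s j) (i := 0) (B := h)
    (((2 * (p + 1) : ℕ) + N) * 2 ^ j) (fun m _ => hh _)
  rw [h₀.add_period] at h1
  have h4 := (le_abs_self _).trans h3
  push_cast at h1 h2 h4
  linarith

end Growth

/-! ### Tangential and normal estimates for one refinement step -/

section Estimates

variable {v : ℝ → Plane} {p : ℕ} {s₀ : ℤ → ℝ} {s d : ℕ → ℤ → ℝ} {C₁ M κ : ℝ} {ξ : ℕ → ℤ → ℝ}

theorem AreNormalParams.abs_sub_le (hξ : AreNormalParams v p s C₁ ξ) (j : ℕ) (K : ℤ) :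
    ∀ k ∈ nbhd p (K / 2),
      |s j k - ξ (j + 1) K| ≤ (|C₁| + (p + 1)) * supNormOn (nbhd p (K / 2)) (fdiff (s j)) := by
  intro k hk
  have h := hξ.near j (K / 2) K (mem_nbhd_union p K) k hk
  rw [abs_sub_comm]
  refine h.trans ?_
  have := supNormOn_nonneg p (K / 2) (fdiff (s j))
  gcongr
  linarith [le_abs_self C₁, (Nat.cast_nonneg p : (0 : ℝ) ≤ p)]

theorem AreNormalParams.abs_next_sub_le (hξ : AreNormalParams v p s C₁ ξ)
    (hs : IsNormalMT v p s₀ s d) (j : ℕ) (K : ℤ) :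
    |s (j + 1) K - ξ (j + 1) K| ≤
      (|C₁| + (p + 1)) * supNormOn (nbhd p (K / 2)) (fdiff (s j)) := by
  set i := K / 2 with hi
  set h := supNormOn (nbhd p i) (fdiff (s j))
  have hh0 : 0 ≤ h := supNormOn_nonneg _ _ _
  have h1 := hξ.near j i K (mem_nbhd_union p K) i (left_mem_nbhd p i)
  have h2 := hs.mem_interval j i K (mem_nbhd_union p K)
  have h3 := abs_sub_le_nat_mul (x := s j) (i := i) (B := h) (p + 1) (fun m hm =>
    abs_le_supNormOn ⟨by omega, by omega⟩ _)
  have h4 : C₁ * h ≤ |C₁| * h := by gcongr; exact le_abs_self _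
  push_cast at h3
  rw [← add_assoc] at h3
  rw [abs_le] at *
  constructor <;> nlinarith [h1.1, h1.2, h2.1, h2.2, h3.1, h3.2]

theorem abs_next_sub_subdiv_le (hv : ContDiff ℝ 3 v) (hu : ∀ t, ‖deriv v t‖ = 1)
    (hM : ∀ t, ‖deriv (deriv (deriv v)) t‖ ≤ M) (hs : IsNormalMT v p s₀ s d)
    (hξ : AreNormalParams v p s C₁ ξ) (j : ℕ) (K : ℤ) :
    |s (j + 1) K - subdiv p (s j) K| ≤
      2 * M * (|C₁| + (p + 1)) ^ 3 * supNormOn (nbhd p (K / 2)) (fdiff (s j)) ^ 3 := by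
  have hM0 : 0 ≤ M := (norm_nonneg _).trans (hM 0)
  have hnear := hξ.abs_sub_le j K
  have hnext := hξ.abs_next_sub_le hs j K
  set h := supNormOn (nbhd p (K / 2)) (fdiff (s j))
  set a := ξ (j + 1) K
  set B := |C₁| + (p + 1)
  -- Pairing with v'(a) removes the detail term, whatever its size.
  have heq := congrArg (dotL (deriv v a)) (hs.refine_eq j K)
  rw [hξ.normal_eq, unitNormal, map_add, map_smul, dotL_perp, smul_zero, add_zero,
    map_subdiv] at heq
  have h1 : |subdiv p (fun k => dotL (deriv v a) (v (s j k)) - dotL (deriv v a) (v a)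
      - (s j k - a)) K| ≤ M * (B * h) ^ 3 := by
    refine abs_subdiv_le _ _ _ _ fun k hk hk' => ?_
    refine (abs_dotL_sub_le hv hu hM a (s j k)).trans ?_
    have := hnear k ⟨hk, by omega⟩
    gcongr
  rw [subdiv_sub, subdiv_sub, subdiv_sub, subdiv_const, subdiv_const] at h1
  have h2 := abs_dotL_sub_le hv hu hM a (s (j + 1) K)
  rw [heq] at h2
  have h3 : M * |s (j + 1) K - a| ^ 3 ≤ M * (B * h) ^ 3 := by gcongr
  have h4 : 2 * M * B ^ 3 * h ^ 3 = 2 * (M * (B * h) ^ 3) := by ring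
  rw [h4]
  simp only [Function.comp_apply] at h2
  rw [abs_le] at *
  constructor <;> linarith [h1.1, h1.2, h2.1, h2.2]

theorem abs_subdiv_fdiff_sq_le {q : ℕ} (hp : p = q + 3) (hv : ContDiff ℝ 3 v)
    (hu : ∀ t, ‖deriv v t‖ = 1)
    (hM : ∀ t, ‖deriv (deriv (deriv v)) t‖ ≤ M) (hκ : 0 < κ) (hk : ∀ t, κ ≤ curvature v t)
    (hξ : AreNormalParams v p s C₁ ξ) (j : ℕ) (K : ℤ) :
    |subdiv (q + 1) (fdiff fun k => (s j k - ξ (j + 1) K) ^ 2) K| ≤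
      4 * M * (|C₁| + (p + 1)) ^ 3 / κ * supNormOn (nbhd p (K / 2)) (fdiff (s j)) ^ 3 := by
  have hM0 : 0 ≤ M := (norm_nonneg _).trans (hM 0)
  have hnear := hξ.abs_sub_le j K
  set h := supNormOn (nbhd p (K / 2)) (fdiff (s j))
  set a := ξ (j + 1) K
  set B := |C₁| + (p + 1)
  have heq := hξ.normal_eq j K
  rw [show p - 2 = q + 1 by omega, approxNormal, unitNormal] at heq
  -- S_{p-2} Δv is parallel to v'(a); only curvature and Taylor remainders survive below.
  have hdet := detL_eq_zero_of_smul_perp heq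
  rw [map_subdiv] at hdet
  have hg : ∀ k ∈ nbhd p (K / 2), |detL (deriv v a) (v (s j k)) - detL (deriv v a) (v a)
      - curvature v a * ((s j k - a) ^ 2 / 2)| ≤ M * (B * h) ^ 3 := fun k hk =>
    (abs_detL_sub_le hv hu hM a (s j k)).trans (by have := hnear k hk; gcongr)
  have h1 : |subdiv (q + 1) (fun k => detL (deriv v a) (fdiff (v ∘ s j) k)
      - curvature v a / 2 * fdiff (fun k => (s j k - a) ^ 2) k) K| ≤ 2 * (M * (B * h) ^ 3) := by
    refine abs_subdiv_le _ _ _ _ fun k hk hk' => ?_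
    have g1 := hg k ⟨hk, by push_cast at hk' ⊢; omega⟩
    have g2 := hg (k + 1) ⟨by omega, by push_cast at hk' ⊢; omega⟩
    simp only [fdiff, map_sub, Function.comp_apply]
    rw [abs_le] at *
    constructor <;> linarith [g1.1, g1.2, g2.1, g2.2]
  rw [subdiv_sub, hdet, zero_sub, abs_neg, subdiv_const_mul, abs_mul] at h1
  have h2 := hk a
  have h3 : κ / 2 ≤ |curvature v a / 2| := (by linarith : κ / 2 ≤ curvature v a / 2).trans
    (le_abs_self _)
  rw [div_mul_eq_mul_div, le_div_iff₀ hκ]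
  have h4 := (mul_le_mul_of_nonneg_right h3 (abs_nonneg _)).trans h1
  have h5 : 4 * M * B ^ 3 * h ^ 3 = 2 * (2 * (M * (B * h) ^ 3)) := by ring
  rw [h5]
  linarith

theorem abs_fdiff_next_le {x y : ℤ → ℝ} {h r : ℝ} (q : ℕ) (hx : ∀ k, |fdiff x k| ≤ h)
    (hr : ∀ k, |y k - subdiv (q + 1) x k| ≤ r) (k : ℤ) : |fdiff y k| ≤ h / 2 + 2 * r := by
  have h1 := hr k
  have h2 := hr (k + 1)
  have h3 := congrFun (fdiff_subdiv q x) k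
  have h4 := abs_subdiv_le q (fdiff x) k h fun k _ _ => hx k
  simp only [fdiff, smul_eq_mul] at h3 h4 ⊢
  rw [abs_le] at *
  constructor <;> linarith [h1.1, h1.2, h2.1, h2.2, h4.1, h4.2]

/-- The first-difference bound is applied to Δy against S_{q+1}(Δx/2), whose error is 2r. -/
theorem abs_fdiff_fdiff_next_le {x y : ℤ → ℝ} {D r : ℝ} (q : ℕ)
    (hx : ∀ k, |fdiff (fdiff x) k| ≤ D) (hr : ∀ k, |y k - subdiv (q + 2) x k| ≤ r) (k : ℤ) :
    |fdiff (fdiff y) k| ≤ D / 4 + 4 * r := by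
  have h1 : ∀ k, |fdiff y k - 1 / 2 * subdiv (q + 1) (fdiff x) k| ≤ 2 * r := by
    intro k
    have h3 := congrFun (fdiff_subdiv (q + 1) x) k
    rw [smul_eq_mul] at h3
    rw [← h3]
    have h4 := abs_fdiff_le_two_mul hr k
    simp only [fdiff] at h4 ⊢
    convert h4 using 2
    ring
  have h1' : ∀ k, |fdiff y k - subdiv (q + 1) (fun i => 1 / 2 * fdiff x i) k| ≤ 2 * r := by
    intro k; rw [subdiv_const_mul]; exact h1 k
  have h2 := abs_fdiff_next_le q (h := D / 2) (fun k => ?_) h1' k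
  · linarith
  · have h5 := congrFun (fdiff_const_smul (1 / 2 : ℝ) (fdiff x)) k
    simp only [smul_eq_mul] at h5
    rw [h5, abs_mul, abs_of_pos (by norm_num : (0 : ℝ) < 1 / 2)]
    linarith [hx k]

end Estimates

end NormalMT

/-! ### The second-order estimate -/

open NormalMT in
theorem proposition3p5 (p : ℕ) (hp : 3 ≤ p)
    (v : ℝ → NormalMT.Plane) (L : ℝ) (hv : NormalMT.IsClosedCurve v L)
    (hv4 : ContDiff ℝ 4 v) (hconvex : ∀ s ∈ Set.Icc 0 L, 0 < NormalMT.curvature v s)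
    (N : ℕ) (hN : ⌈(p : ℚ) / 2⌉₊ + 1 ≤ N)
    (s₀ : ℤ → ℝ) (hs₀ : NormalMT.IsInitialData L N s₀)
    (s d : ℕ → ℤ → ℝ) (hs : NormalMT.IsNormalMT v p s₀ s d)
    (hconv : NormalMT.Converges s)
    (C₁ : ℝ) (ξ : ℕ → ℤ → ℝ) (hξ : NormalMT.AreNormalParams v p s C₁ ξ) :
    ∃ C : ℝ, 0 < C ∧ ∀ j : ℕ, 1 ≤ j → ∀ K : ℤ,
      |ξ j K - s j K| ≤ C * NormalMT.supNorm (NormalMT.fdiff (s (j - 1))) ^ 2 := by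
  obtain ⟨q, hq⟩ : ∃ q, p = q + 3 := ⟨p - 3, by omega⟩
  have hL := hv.length_pos
  have hu := hv.unit_speed
  have hv3 : ContDiff ℝ 3 v := hv4.of_le (by norm_num)
  have hv1 : ContDiff ℝ 2 (deriv v) := (contDiff_succ_iff_deriv (n := 2)).1 hv3 |>.2.2
  have hv2 : ContDiff ℝ 1 (deriv (deriv v)) := (contDiff_succ_iff_deriv (n := 1)).1 hv1 |>.2.2
  obtain ⟨M, hM⟩ := exists_norm_le_of_periodic hL
    (periodic_deriv (periodic_deriv (periodic_deriv hv.periodic))) (hv2.continuous_deriv le_rfl)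
  have hM0 : 0 ≤ M := (norm_nonneg _).trans (hM 0)
  obtain ⟨κ, hκ, hk⟩ := exists_pos_le_of_periodic hL (periodic_curvature hv.periodic)
    (continuous_curvature (hv3.of_le (by norm_num))) hconvex
  obtain ⟨H, hH⟩ := hs.exists_abs_fdiff_le hs₀ (by omega)
  set B : ℝ := |C₁| + (p + 1) with hB
  have hB0 : 0 ≤ B := by positivity
  set h : ℕ → ℝ := fun j => supNorm (fdiff (s j)) with hh
  set D : ℕ → ℝ := fun j => supNorm (fdiff (fdiff (s j))) with hDdef
  have hbd : ∀ j k, |fdiff (s j) k| ≤ h j := fun j k =>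
    abs_le_supNorm ⟨H, by rintro _ ⟨k, rfl⟩; exact hH j k⟩ k
  have hDle : ∀ j k, |fdiff (fdiff (s j)) k| ≤ D j := fun j k =>
    abs_le_supNorm ⟨2 * H, by rintro _ ⟨k, rfl⟩; exact abs_fdiff_le_two_mul (hH j) k⟩ k
  have hh0 : ∀ j, 0 ≤ h j := fun j => (abs_nonneg _).trans (hbd j 0)
  have hhH : ∀ j, h j ≤ H := fun j => supNorm_le (hH j)
  have hloc : ∀ j i, supNormOn (nbhd p i) (fdiff (s j)) ≤ h j := fun j i =>
    supNormOn_le fun k _ => hbd j k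
  have hloc0 : ∀ j i, 0 ≤ supNormOn (nbhd p i) (fdiff (s j)) := fun j i => supNormOn_nonneg _ _ _
  have hr : ∀ j K, |s (j + 1) K - subdiv p (s j) K| ≤ 2 * M * B ^ 3 * h j ^ 3 := by
    intro j K
    refine (abs_next_sub_subdiv_le hv3 hu hM hs hξ j K).trans ?_
    have := hloc j (K / 2)
    have := hloc0 j (K / 2)
    gcongr
  have hr' : ∀ j K, |s (j + 1) K - subdiv (q + 3) (s j) K| ≤ 2 * M * B ^ 3 * h j ^ 3 :=
    hq ▸ hr
  obtain ⟨C₂, hC₂, hD⟩ : ∃ C, 0 ≤ C ∧ ∀ j, D j ≤ C * h j ^ 2 := by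
    have hden : (0 : ℝ) < N + 2 * (p + 1) := by positivity
    -- A second difference collects four errors 2MB³h³, hence 8MB³; the 1 ensures R ≥ 1.
    refine exists_le_mul_sq (c := L / (N + 2 * (p + 1))) (R := 8 * M * B ^ 3 + 1)
      (by positivity) (by have : 0 ≤ 8 * M * B ^ 3 := by positivity
                          linarith)
      (fun j => ?_) (fun j => supNorm_le (abs_fdiff_le_two_mul (hbd j)))
      (fun j => (abs_nonneg _).trans (hDle j 0)) (fun j => ?_) (fun j => ?_)
    · rw [div_le_iff₀ hden]
      exact hs.length_le hs₀ j (hbd j)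
    · refine supNorm_le fun k => ?_
      refine (abs_fdiff_next_le (q + 2) (hbd j) (hr' j) k).trans ?_
      have h1 : 0 ≤ M * B ^ 3 * h j ^ 3 := by have := hh0 j; positivity
      have h2 : 0 ≤ h j ^ 3 := by have := hh0 j; positivity
      linarith
    · refine supNorm_le fun k => ?_
      refine (abs_fdiff_fdiff_next_le (q + 1) (hDle j) (hr' j) k).trans ?_
      have h2 : 0 ≤ h j ^ 3 := by have := hh0 j; positivity
      linarith
  set E := 4 * M * B ^ 3 / κ with hE
  have hE0 : 0 ≤ E := by positivity
  set C₃ : ℝ := E + 2 * (q + 4) ^ 2 * (2 * B + (q + 4)) + (q + 4) ^ 2 + 2 * B * (q + 4) with hC₃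
  have hC₃0 : 0 ≤ C₃ := by positivity
  have hH0 : 0 ≤ H := (hh0 0).trans (hhH 0)
  -- The first term bounds S_p s − ξ, the second s^{j+1} − S_p s through h³ ≤ H h²; the 1 gives
  -- positivity.
  refine ⟨C₃ * (1 + C₂) + 2 * M * B ^ 3 * H + 1, by positivity, fun j hj K => ?_⟩
  obtain ⟨j, rfl⟩ : ∃ i, j = i + 1 := ⟨j - 1, by omega⟩
  rw [Nat.add_sub_cancel]
  change _ ≤ _ * h j ^ 2
  set u : ℤ → ℝ := fun k => s j k - ξ (j + 1) K with hu'
  have hfu : fdiff u = fdiff (s j) := by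
    funext k; simp only [fdiff, hu']; ring
  have h1 := abs_subdiv_le_of_subdiv_fdiff_sq q u K (supNormOn (nbhd p (K / 2)) (fdiff (s j)))
    (D j) B E (by rw [hfu, hq]) (by rw [hfu]; exact hDle j) hB0
    (by rw [← hq]; exact hξ.abs_sub_le j K) hE0
    (abs_subdiv_fdiff_sq_le hq hv3 hu hM hκ hk hξ j K)
  rw [← hq, subdiv_sub, subdiv_const, ← hC₃] at h1
  have h2 : supNormOn (nbhd p (K / 2)) (fdiff (s j)) ^ 2 + D j ≤ (1 + C₂) * h j ^ 2 := by
    have := hloc j (K / 2)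
    have h3 := hloc0 j (K / 2)
    have h4 : supNormOn (nbhd p (K / 2)) (fdiff (s j)) ^ 2 ≤ h j ^ 2 := by gcongr
    linarith [hD j]
  have h3 := h1.trans (mul_le_mul_of_nonneg_left h2 hC₃0)
  have h4 : 2 * M * B ^ 3 * h j ^ 3 ≤ 2 * M * B ^ 3 * H * h j ^ 2 := by
    have := hhH j
    have := hh0 j
    calc 2 * M * B ^ 3 * h j ^ 3 = 2 * M * B ^ 3 * h j * h j ^ 2 := by ring
      _ ≤ _ := by gcongr
  have h5 := hr j K
  have h6 : 0 ≤ h j ^ 2 := sq_nonneg _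
  rw [abs_le] at *
  constructor <;> linarith [h3.1, h3.2, h5.1, h5.2]
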